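/- Let $P_n$ ($n\ge 0$) be the Legendre polynomials, $P_{-1}:=0$, and let $C_n^{(\lambda)}$ be the ultraspherical polynomials, for all real $\lambda$ given by $C_0^{(\lambda)}=1$, $C_1^{(\lambda)}(x)=2\lambda x$, $(n+2)C_{n+2}^{(\lambda)}(x)=2(n+1+\lambda)xC_{n+1}^{(\lambda)}(x)-(n+2\lambda)C_n^{(\lambda)}(x)$. Let $\log$ be the principal branch of the logarithm (with $\arg\in(-\pi,\pi]$ and $0\log 0:=0$), and let $\log_- z:=\log|z|-\mathrm i\pi$ if $z$ is real and negative, $\log_- z:=\log z$ otherwise. Let $\Omega=\{x+\mathrm iy:-1\le x,y\le 1\}$ and, for $z\in\mathbb C$ and integers $k,j\ge -1$, $$L_{kj}(z)=\int_{-1}^1\!\int_{-1}^1\log\bigl(z-(s+\mathrm it)\bigr)P_k(s)P_j(t)\,ds\,dt,$$ $$L_k(z)=\int_{-1}^1\log(z-t)P_k(t)\,dt,\qquad M_k(z)=\int_{-1}^1\log(z-\mathrm it)P_k(t)\,dt,$$ so that $L_{-1,j}=L_{k,-1}=L_{-1}=M_{-1}=0$. For $z=x+\mathrm iy$ and $k\ge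 0$ put $$\lambda_k(z)=\begin{cases}(z-1)\log(z-1)+(z+1)\log(z+1)&k=0\\-2/3&k=1\\0&k\ge2,\end{cases}$$ $$\mu_k(z)=\begin{cases}(z-\mathrm i)\log(z-\mathrm i)+(z+\mathrm i)\log_-(z+\mathrm i)&k=0\\-2\mathrm i/3&k=1\\0&k\ge2\end{cases}\;-\;\begin{cases}2\mathrm i\pi x\,C_{k+1}^{(-1/2)}(y)&x<0\text{ and }-1<y<1\\0&\text{otherwise.}\end{cases}$$ Then all these integrals converge absolutely, and for all integers $k,j\ge0$ and every $z=x+\mathrm iy\in\mathbb C$, $$zL_{kj}=\frac{k-1}{2k+1}L_{k-1,j}+\frac{k+2}{2k+1}L_{k+1,j}+\mathrm i\Bigl(\frac{j}{2j+1}L_{k,j-1}+\frac{j+1}{2j+1}L_{k,j+1}\Bigr)+F^{(1)}_{kj}(z),$$ $$zL_{kj}=\frac{k}{2k+1}L_{k-1,j}+\frac{k+1}{2k+1}L_{k+1,j}+\mathrm i\Bigl(\frac{j-1}{2j+1}L_{k,j-1}+\frac{j+2}{2j+1}L_{k,j+1}\Bigr)+F^{(2)}_{kj}(z),$$ where all $L$'s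 are evaluated at $z$, $$F^{(1)}_{0j}(z)=\mathrm i\,\frac{M_{j+1}(z-1)+M_{j+1}(z+1)-M_{j-1}(z-1)-M_{j-1}(z+1)}{2j+1}+\mu_j(z-1)+\mu_j(z+1),$$ $F^{(1)}_{10}(z)=-4/3$, and $F^{(1)}_{kj}(z)=0$ for $k\ne0$, $(k,j)\ne(1,0)$; $$F^{(2)}_{k0}(z)=\frac{L_{k+1}(z-\mathrm i)+L_{k+1}(z+\mathrm i)-L_{k-1}(z-\mathrm i)-L_{k-1}(z+\mathrm i)}{2k+1}+\lambda_k(z-\mathrm i)+\lambda_k(z+\mathrm i)+\beta_{k0}(z),$$ $F^{(2)}_{01}(z)=-4\mathrm i/3+\beta_{01}(z)$, and $F^{(2)}_{kj}(z)=\beta_{kj}(z)$ for $j\ne0$, $(k,j)\ne(0,1)$; and $$\beta_{kj}(z)=2\mathrm i\pi\,C_{j+1}^{(-1/2)}(y)\begin{cases}C_{k+2}^{(-3/2)}(x)/3-\delta_{k0}x+\delta_{k1}/3&z\in\Omega\text{ and }y\ne1\\-2x\,\delta_{k0}+2\delta_{k1}/3&x<-1\text{ and }-1\le y<1\\0&\text{otherwise.}\end{cases}$$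 -/

import Mathlib

namespace NewtonianLog

noncomputable section

open Complex

/-- The Legendre polynomials `P_n`, `n ≥ 0`, as real functions, through
`P_0 = 1`, `P_1 = x`, `(n + 2) P_{n+2} = (2n + 3) x P_{n+1} - (n + 1) P_n`. -/
def legendreNat : ℕ → ℝ → ℝ
  | 0, _ => 1
  | 1, x => x
  | n + 2, x =>
      ((2 * (n : ℝ) + 3) * x * legendreNat (n + 1) x - ((n : ℝ) + 1) * legendreNat n x)
        / ((n : ℝ) + 2)

/-- The Legendre polynomials with an integer index, where `P_n = 0` for `n < 0`. -/
def legendreP (n : ℤ) (x : ℝ) : ℝ :=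
  if n < 0 then 0 else legendreNat n.toNat x

/-- The ultraspherical (Gegenbauer) polynomials `C_n^{(lam)}`, for every real parameter `lam`, in
the standard normalisation: `C_0 = 1`, `C_1 = 2 lam x`,
`(n + 2) C_{n+2} = 2 (n + 1 + lam) x C_{n+1} - (n + 2 lam) C_n`. -/
def ultraspherical (lam : ℝ) : ℕ → ℝ → ℝ
  | 0, _ => 1
  | 1, x => 2 * lam * x
  | n + 2, x =>
      (2 * ((n : ℝ) + 1 + lam) * x * ultraspherical lam (n + 1) x
        - ((n : ℝ) + 2 * lam) * ultraspherical lam n x) / ((n : ℝ) + 2)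

/-- The square `Ω = {(x, y) : -1 ≤ x, y ≤ 1}`. -/
def square : Set (ℝ × ℝ) := Set.Icc (-1) 1 ×ˢ Set.Icc (-1) 1

/-- The integrand `log (z - t) P_k(t)` of `L_k(z)`. -/
def logKernel (k : ℤ) (z : ℂ) (t : ℝ) : ℂ := log (z - t) * (legendreP k t : ℂ)

/-- `L_k(z) = ∫_{-1}^1 log (z - t) P_k(t) dt`, with the principal branch of the logarithm. -/
def logL (k : ℤ) (z : ℂ) : ℂ := ∫ t in (-1 : ℝ)..1, logKernel k z t

/-- The integrand `log (z - i t) P_k(t)` of `M_k(z)`. -/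
def logKernelI (k : ℤ) (z : ℂ) (t : ℝ) : ℂ := log (z - I * t) * (legendreP k t : ℂ)

/-- `M_k(z) = ∫_{-1}^1 log (z - i t) P_k(t) dt`. -/
def logM (k : ℤ) (z : ℂ) : ℂ := ∫ t in (-1 : ℝ)..1, logKernelI k z t

/-- The integrand `log (z - (s + i t)) P_k(s) P_j(t)` of `L_{kj}(z)`, at `p = (s, t)`. -/
def logKernel₂ (k j : ℤ) (z : ℂ) (p : ℝ × ℝ) : ℂ :=
  log (z - (p.1 + I * p.2)) * ((legendreP k p.1 * legendreP j p.2 : ℝ) : ℂ)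

/-- `L_{kj}(z) = ∬_Ω log (z - (s + i t)) P_k(s) P_j(t) ds dt`. In particular
`L_{-1,j} = L_{k,-1} = 0`. -/
def logL₂ (k j : ℤ) (z : ℂ) : ℂ := ∫ p in square, logKernel₂ k j z p

/-- `λ_k(z)`. -/
def lambdaTerm (k : ℕ) (z : ℂ) : ℂ :=
  if k = 0 then (z - 1) * log (z - 1) + (z + 1) * log (z + 1)
  else if k = 1 then -2 / 3
  else 0

/-- The logarithm `log_-` that takes the other limit along its branch cut. -/
def logMinus (z : ℂ) : ℂ :=
  if z.im = 0 ∧ z.re < 0 then (Real.log ‖z‖ : ℂ) - I * (Real.pi : ℂ) else log z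

/-- `μ_k(z)`. -/
def muTerm (k : ℕ) (z : ℂ) : ℂ :=
  (if k = 0 then (z - I) * log (z - I) + (z + I) * logMinus (z + I)
    else if k = 1 then -2 * I / 3
    else 0)
  - (if z.re < 0 ∧ -1 < z.im ∧ z.im < 1 then
      2 * I * (Real.pi : ℂ) * (z.re : ℂ) * (ultraspherical (-1 / 2) (k + 1) z.im : ℂ)
    else 0)

open Classical in
/-- The factor of `β_{kj}(z)` that is given by cases; `z = x + i y` with `x = z.re`, `y = z.im`. -/
def betaFactor (k : ℕ) (z : ℂ) : ℝ :=
  if (z.re, z.im) ∈ square ∧ z.im ≠ 1 then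
    ultraspherical (-3 / 2) (k + 2) z.re / 3
      - (if k = 0 then z.re else 0) + (if k = 1 then 1 / 3 else 0)
  else if z.re < -1 ∧ -1 ≤ z.im ∧ z.im < 1 then
    (if k = 0 then -2 * z.re else 0) + (if k = 1 then 2 / 3 else 0)
  else 0

/-- `β_{kj}(z)`. -/
def betaTerm (k j : ℕ) (z : ℂ) : ℂ :=
  2 * I * (Real.pi : ℂ) * (ultraspherical (-1 / 2) (j + 1) z.im : ℂ) * (betaFactor k z : ℂ)

/-- The inhomogeneity `F_{kj}^{(1)}(z)` of the first recurrence. -/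
def inhomOne (k j : ℕ) (z : ℂ) : ℂ :=
  if k = 0 then
    I * (logM ((j : ℤ) + 1) (z - 1) + logM ((j : ℤ) + 1) (z + 1)
        - logM ((j : ℤ) - 1) (z - 1) - logM ((j : ℤ) - 1) (z + 1)) / (2 * (j : ℂ) + 1)
      + muTerm j (z - 1) + muTerm j (z + 1)
  else if k = 1 ∧ j = 0 then -4 / 3
  else 0

/-- The inhomogeneity `F_{kj}^{(2)}(z)` of the second recurrence. -/
def inhomTwo (k j : ℕ) (z : ℂ) : ℂ :=
  if j = 0 then
    (logL ((k : ℤ) + 1) (z - I) + logL ((k : ℤ) + 1) (z + I)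
        - logL ((k : ℤ) - 1) (z - I) - logL ((k : ℤ) - 1) (z + I)) / (2 * (k : ℂ) + 1)
      + lambdaTerm k (z - I) + lambdaTerm k (z + I) + betaTerm k 0 z
  else if k = 0 ∧ j = 1 then -4 * I / 3 + betaTerm 0 1 z
  else betaTerm k j z

end

end NewtonianLog

namespace NewtonianLog

open Complex MeasureTheory

/-! ### Ultraspherical and Legendre polynomials -/

/-! Put w = z - (s + it). Writing z = w + s + it under the integral and applying the three-term
recurrence to s P_k(s) and t P_j(t) expresses z L_{kj} through the four neighbours and J = ∬ w log w
P_k(s) P_j(t) (`mul_logL₂`). Both recurrences come from this identity; they differ only in the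
variable in which J is integrated by parts.

The function P_k has the antiderivative Q_k = -C_{k+1}^{(-1/2)} = (P_{k+1} - P_{k-1})/(2k+1), and w
log w has derivative log w + 1. Integration by parts in s thus gives (L_{k+1,j} - L_{k-1,j})/(2k+1),
which shifts the coefficients k and k+1 to k-1 and k+2, plus boundary terms; these, integrated
against P_j, form F^{(1)}. The variable t is treated in the same way and yields F^{(2)}.

The difficulty is the branch cut. A horizontal segment stays in one closed half-plane, where w log w
is continuous up to the appropriate boundary value. A vertical segment crosses the cut at t = y when
x < 0, and the jump 2πi of the logarithm adds 2πi x Q_k(y) to `muTerm`. For the square, x becomes x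
- s, and integrating the jump against P_k(s) produces β_{kj}. -/

theorem ultraspherical_add_two (lam : ℝ) (n : ℕ) (x : ℝ) :
    ((n : ℝ) + 2) * ultraspherical lam (n + 2) x =
      2 * ((n : ℝ) + 1 + lam) * x * ultraspherical lam (n + 1) x
        - ((n : ℝ) + 2 * lam) * ultraspherical lam n x := by
  have : (n : ℝ) + 2 ≠ 0 := by positivity
  rw [ultraspherical]
  field_simp

/-- The two identities need a joint induction: the second at n + 1 follows from the first at n and
the recurrence for lam + 1, and the first at n + 1 then uses both. -/
theorem ultraspherical_contiguous (lam : ℝ) (x : ℝ) (n : ℕ) :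
    ((n : ℝ) + 2) * ultraspherical lam (n + 2) x =
        2 * lam * (x * ultraspherical (lam + 1) (n + 1) x - ultraspherical (lam + 1) n x) ∧
      ((n : ℝ) + 1 + 2 * lam) * ultraspherical lam (n + 1) x =
        2 * lam * (ultraspherical (lam + 1) (n + 1) x - x * ultraspherical (lam + 1) n x) := by
  induction n with
  | zero =>
    constructor
    · rw [ultraspherical_add_two]
      simp only [ultraspherical]
      push_cast
      ring
    · simp only [ultraspherical]
      push_cast
      ring
  | succ n ih =>
    obtain ⟨hX, hY⟩ := ih
    have hD := ultraspherical_add_two (lam + 1) n x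
    have hC := ultraspherical_add_two lam (n + 1) x
    have hn : (n : ℝ) + 2 ≠ 0 := by positivity
    have hY' : ((n : ℝ) + 2 + 2 * lam) * ultraspherical lam (n + 2) x =
        2 * lam * (ultraspherical (lam + 1) (n + 2) x
          - x * ultraspherical (lam + 1) (n + 1) x) := by
      apply mul_left_cancel₀ hn
      linear_combination ((n : ℝ) + 2 + 2 * lam) * hX - 2 * lam * hD
    push_cast at hC ⊢
    refine ⟨?_, ?_⟩
    · rw [show (n : ℝ) + 1 + 2 = n + 3 by ring] at *
      linear_combination hC + x * hX - hY + x * hY'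
    · linear_combination hY'

/-- In the sum of the two contiguous relations for C_{n+2}, the terms x C_{n+1}^{(lam+1)} cancel. -/
theorem ultraspherical_sub (lam : ℝ) (x : ℝ) (n : ℕ) :
    ((n : ℝ) + 2 + lam) * ultraspherical lam (n + 2) x =
      lam * (ultraspherical (lam + 1) (n + 2) x - ultraspherical (lam + 1) n x) := by
  have h1 := (ultraspherical_contiguous lam x n).1
  have h2 := (ultraspherical_contiguous lam x (n + 1)).2
  push_cast at h2
  linear_combination (h1 + h2) / 2

/-- Differentiating the recurrence leaves one undifferentiated term C_{n+2}^{(lam)}, which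
`ultraspherical_sub` converts to parameter lam + 1. -/
theorem hasDerivAt_ultraspherical (lam : ℝ) (x : ℝ) (n : ℕ) :
    HasDerivAt (ultraspherical lam (n + 1)) (2 * lam * ultraspherical (lam + 1) n x) x := by
  induction n using Nat.strong_induction_on with
  | _ n ih =>
    match n, ih with
    | 0, _ => simpa [ultraspherical] using (hasDerivAt_id x).const_mul (2 * lam)
    | 1, _ =>
      have h1 : HasDerivAt (ultraspherical lam 1) (2 * lam) x := by
        simpa [ultraspherical] using (hasDerivAt_id x).const_mul (2 * lam)
      have h := ((((hasDerivAt_id x).const_mul (2 * ((0 : ℝ) + 1 + lam))).mul h1).sub_const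
        ((0 + 2 * lam) * 1)).div_const (0 + 2)
      refine (h.congr_deriv ?_).congr_of_eventuallyEq (Filter.Eventually.of_forall fun y => ?_)
      · simp only [ultraspherical, id]
        ring
      · simp [ultraspherical]
    | n + 2, ih =>
      have h0 := ih n (by omega)
      have h1 := ih (n + 1) (by omega)
      have h := ((((hasDerivAt_id x).const_mul (2 * (((n + 1 : ℕ) : ℝ) + 1 + lam))).mul h1).sub
        (h0.const_mul (((n + 1 : ℕ) : ℝ) + 2 * lam))).div_const (((n + 1 : ℕ) : ℝ) + 2)
      refine (h.congr_deriv ?_).congr_of_eventuallyEq (Filter.Eventually.of_forall fun y => ?_)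
      · have hs := ultraspherical_sub lam x n
        have hD := ultraspherical_add_two (lam + 1) n x
        have : ((n : ℝ) + 1 + 2) ≠ 0 := by positivity
        push_cast
        rw [div_eq_iff this]
        simp only [id]
        linear_combination 2 * hs - 2 * lam * hD
      · simp [ultraspherical]

theorem continuous_ultraspherical (lam : ℝ) (n : ℕ) : Continuous (ultraspherical lam n) := by
  cases n with
  | zero => exact continuous_const
  | succ n =>
    exact continuous_iff_continuousAt.2 fun x => (hasDerivAt_ultraspherical lam x n).continuousAt

/-- Lowering the parameter from 1/2 to -1/2 and -3/2 then gives the first and second antiderivatives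
through one derivative rule. -/
theorem legendreNat_eq_ultraspherical (n : ℕ) (x : ℝ) :
    legendreNat n x = ultraspherical (1 / 2) n x := by
  induction n using Nat.strong_induction_on with
  | _ n ih =>
    match n, ih with
    | 0, _ => rfl
    | 1, _ => simp [legendreNat, ultraspherical]
    | n + 2, ih =>
      rw [legendreNat, ultraspherical, ih n (by omega), ih (n + 1) (by omega)]
      congr 1
      ring

theorem legendreNat_one (n : ℕ) : legendreNat n 1 = 1 := by
  induction n using Nat.strong_induction_on with
  | _ n ih =>
    match n, ih with
    | 0, _ => rfl
    | 1, _ => rfl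
    | n + 2, ih =>
      have : (n : ℝ) + 2 ≠ 0 := by positivity
      rw [legendreNat, ih n (by omega), ih (n + 1) (by omega), div_eq_iff this]
      ring

theorem legendreNat_neg_one (n : ℕ) : legendreNat n (-1) = (-1) ^ n := by
  induction n using Nat.strong_induction_on with
  | _ n ih =>
    match n, ih with
    | 0, _ => simp [legendreNat]
    | 1, _ => simp [legendreNat]
    | n + 2, ih =>
      have : (n : ℝ) + 2 ≠ 0 := by positivity
      rw [legendreNat, ih n (by omega), ih (n + 1) (by omega), div_eq_iff this]
      ring

theorem legendreP_natCast (n : ℕ) (x : ℝ) : legendreP n x = legendreNat n x := by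
  simp [legendreP]

theorem legendreP_natCast_add_one (n : ℕ) (x : ℝ) :
    legendreP ((n : ℤ) + 1) x = legendreNat (n + 1) x := by
  exact_mod_cast legendreP_natCast (n + 1) x

theorem legendreP_neg_one (x : ℝ) : legendreP (-1) x = 0 := by
  simp [legendreP]

theorem continuous_legendreP (k : ℤ) : Continuous (legendreP k) := by
  unfold legendreP
  split_ifs
  · exact continuous_const
  · simp only [legendreNat_eq_ultraspherical]
    exact continuous_ultraspherical _ _

theorem mul_legendreP (k : ℕ) (x : ℝ) :
    x * legendreP k x = (k : ℝ) / (2 * k + 1) * legendreP ((k : ℤ) - 1) x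
      + ((k : ℝ) + 1) / (2 * k + 1) * legendreP ((k : ℤ) + 1) x := by
  have h : (2 * (k : ℝ) + 1) ≠ 0 := by positivity
  cases k with
  | zero => simp [legendreP, legendreNat]
  | succ k =>
    have h2 : (k : ℝ) + 2 ≠ 0 := by positivity
    rw [legendreP_natCast_add_one, legendreP_natCast,
      show (((k + 1 : ℕ) : ℤ) - 1) = (k : ℤ) by push_cast; ring, legendreP_natCast, legendreNat]
    push_cast at h ⊢
    field_simp
    ring

/-- The antiderivative `-C_{k+1}^{(-1/2)}` of the Legendre polynomial `P_k`. -/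
noncomputable def legendreAnti (k : ℕ) (x : ℝ) : ℝ := -ultraspherical (-1 / 2) (k + 1) x

/-- In this form integration by parts returns the neighbouring indices k ± 1; for k = 0 it relies on
P_{-1} = 0. -/
theorem legendreAnti_eq (k : ℕ) (x : ℝ) :
    legendreAnti k x = (legendreP ((k : ℤ) + 1) x - legendreP ((k : ℤ) - 1) x) / (2 * k + 1) := by
  have h : (2 * (k : ℝ) + 1) ≠ 0 := by positivity
  rw [eq_div_iff h, legendreAnti, legendreP_natCast_add_one]
  cases k with
  | zero =>
    simp [legendreP_neg_one, ultraspherical, legendreNat]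
    ring
  | succ k =>
    have h1 := ultraspherical_sub (-1 / 2) x k
    rw [show (-1 / 2 : ℝ) + 1 = 1 / 2 by norm_num] at h1
    rw [show (((k + 1 : ℕ) : ℤ) - 1) = (k : ℤ) by push_cast; ring, legendreP_natCast,
      legendreNat_eq_ultraspherical, legendreNat_eq_ultraspherical]
    push_cast
    linear_combination -2 * h1

theorem hasDerivAt_legendreAnti (k : ℕ) (x : ℝ) :
    HasDerivAt (legendreAnti k) (legendreP k x) x := by
  refine (hasDerivAt_ultraspherical (-1 / 2) x k).neg.congr_deriv ?_
  rw [legendreP_natCast, legendreNat_eq_ultraspherical,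
    show (-1 / 2 : ℝ) + 1 = 1 / 2 by norm_num]
  ring

theorem continuous_legendreAnti (k : ℕ) : Continuous (legendreAnti k) :=
  (continuous_ultraspherical _ _).neg

theorem legendreAnti_one (k : ℕ) : legendreAnti k 1 = if k = 0 then 1 else 0 := by
  rw [legendreAnti_eq]
  rcases k with _ | k
  · simp [legendreP, legendreNat]
  · rw [legendreP_natCast_add_one, show (((k + 1 : ℕ) : ℤ) - 1) = (k : ℤ) by push_cast; ring,
      legendreP_natCast, legendreNat_one, legendreNat_one]
    simp

theorem legendreAnti_neg_one (k : ℕ) : legendreAnti k (-1) = if k = 0 then -1 else 0 := by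
  rw [legendreAnti_eq]
  rcases k with _ | k
  · simp [legendreP, legendreNat]
  · rw [legendreP_natCast_add_one, show (((k + 1 : ℕ) : ℤ) - 1) = (k : ℤ) by push_cast; ring,
      legendreP_natCast, legendreNat_neg_one, legendreNat_neg_one]
    simp [pow_succ]

/-- The second antiderivative `C_{k+2}^{(-3/2)} / 3` of the Legendre polynomial `P_k`. -/
noncomputable def legendreAnti₂ (k : ℕ) (x : ℝ) : ℝ := ultraspherical (-3 / 2) (k + 2) x / 3

theorem hasDerivAt_legendreAnti₂ (k : ℕ) (x : ℝ) :
    HasDerivAt (legendreAnti₂ k) (legendreAnti k x) x := by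
  refine ((hasDerivAt_ultraspherical (-3 / 2) x (k + 1)).div_const 3).congr_deriv ?_
  rw [legendreAnti, show (-3 / 2 : ℝ) + 1 = -1 / 2 by norm_num]
  ring

/-- Serves to find the endpoint values: both terms on the right vanish at x = ±1, which leaves only
k = 0 and k = 1 to compute by hand. -/
theorem legendreAnti₂_add_two (k : ℕ) (x : ℝ) :
    ((k : ℝ) + 4) * legendreAnti₂ (k + 2) x =
      x * legendreAnti (k + 2) x - legendreAnti (k + 1) x := by
  have h := (ultraspherical_contiguous (-3 / 2) x (k + 2)).1
  rw [show (-3 / 2 : ℝ) + 1 = -1 / 2 by norm_num] at h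
  push_cast at h
  simp only [legendreAnti₂, legendreAnti]
  linear_combination h / 3

theorem legendreAnti₂_one (k : ℕ) :
    legendreAnti₂ k 1 = if k = 0 then 1 else if k = 1 then -1 / 3 else 0 := by
  match k with
  | 0 => norm_num [legendreAnti₂, ultraspherical]
  | 1 => norm_num [legendreAnti₂, ultraspherical]
  | k + 2 =>
    have h := legendreAnti₂_add_two k 1
    have h4 : (k : ℝ) + 4 ≠ 0 := by positivity
    simpa [legendreAnti_one, h4] using h

theorem legendreAnti₂_neg_one (k : ℕ) :
    legendreAnti₂ k (-1) = if k = 0 then 1 else if k = 1 then 1 / 3 else 0 := by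
  match k with
  | 0 => norm_num [legendreAnti₂, ultraspherical]
  | 1 => norm_num [legendreAnti₂, ultraspherical]
  | k + 2 =>
    have h := legendreAnti₂_add_two k (-1)
    have h4 : (k : ℝ) + 4 ≠ 0 := by positivity
    simpa [legendreAnti_neg_one, h4] using h

/-! ### Moments of Legendre polynomials -/

theorem integral_legendreP (k : ℕ) :
    ∫ s in (-1 : ℝ)..1, legendreP k s = if k = 0 then 2 else 0 := by
  rw [intervalIntegral.integral_eq_sub_of_hasDerivAt
    (fun x _ => hasDerivAt_legendreAnti k x) ((continuous_legendreP k).intervalIntegrable _ _),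
    legendreAnti_one, legendreAnti_neg_one]
  split_ifs <;> norm_num

theorem integral_legendreAnti (k : ℕ) :
    ∫ s in (-1 : ℝ)..1, legendreAnti k s = if k = 1 then -2 / 3 else 0 := by
  rw [intervalIntegral.integral_eq_sub_of_hasDerivAt
    (fun x _ => hasDerivAt_legendreAnti₂ k x) ((continuous_legendreAnti k).intervalIntegrable _ _),
    legendreAnti₂_one, legendreAnti₂_neg_one]
  rcases k with _ | _ | k <;> norm_num

theorem integral_sub_mul_legendreP (k : ℕ) (x a b : ℝ) :
    ∫ s in a..b, (s - x) * legendreP k s =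
      ((b - x) * legendreAnti k b - legendreAnti₂ k b)
        - ((a - x) * legendreAnti k a - legendreAnti₂ k a) := by
  refine intervalIntegral.integral_eq_sub_of_hasDerivAt
    (f := fun s => (s - x) * legendreAnti k s - legendreAnti₂ k s) (fun s _ => ?_)
    (((continuous_id.sub continuous_const).mul (continuous_legendreP k)).intervalIntegrable _ _)
  refine ((((hasDerivAt_id s).sub_const x).mul (hasDerivAt_legendreAnti k s)).sub
    (hasDerivAt_legendreAnti₂ k s)).congr_deriv ?_
  simp only [id]
  ring

theorem integral_sub_mul_legendreP_Icc (k : ℕ) (x : ℝ) :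
    ∫ s in (-1 : ℝ)..1, (s - x) * legendreP k s =
      (if k = 0 then -2 * x else 0) + (if k = 1 then 2 / 3 else 0) := by
  rw [integral_sub_mul_legendreP, legendreAnti_one, legendreAnti_neg_one, legendreAnti₂_one,
    legendreAnti₂_neg_one]
  rcases k with _ | _ | k <;> norm_num
  ring

/-- Source of the case z ∈ Ω of β: the lower limit contributes only the second antiderivative at x,
since the factor s - x vanishes there. -/
theorem integral_sub_mul_legendreP_right (k : ℕ) (x : ℝ) :
    ∫ s in x..1, (s - x) * legendreP k s =
      ultraspherical (-3 / 2) (k + 2) x / 3 - (if k = 0 then x else 0)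
        + (if k = 1 then 1 / 3 else 0) := by
  rw [integral_sub_mul_legendreP, legendreAnti_one, legendreAnti₂_one, legendreAnti₂]
  rcases k with _ | _ | k <;> norm_num <;> ring


/-! ### Integrability of the logarithm along lines -/

theorem norm_log_le_add_pi (w : ℂ) : ‖log w‖ ≤ |Real.log ‖w‖| + Real.pi := by
  refine (norm_le_abs_re_add_abs_im _).trans ?_
  rw [log_re, log_im]
  gcongr
  exact abs_arg_le_pi w

/-- Intended for a real coordinate a of w (possibly after a rotation): log‖w‖ lies between log|a|
and ‖w‖, so a one-variable real logarithm dominates the singularity. -/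
theorem norm_log_le_of_le_norm {w : ℂ} {a : ℝ} (ha : a ≠ 0) (h : |a| ≤ ‖w‖) :
    ‖log w‖ ≤ ‖w‖ + Real.pi + |Real.log a| := by
  have hw : 0 < ‖w‖ := (abs_pos.2 ha).trans_le h
  suffices |Real.log ‖w‖| ≤ ‖w‖ + |Real.log a| by linarith [norm_log_le_add_pi w]
  have h1 := Real.log_le_sub_one_of_pos hw
  have h2 := Real.log_le_log (abs_pos.2 ha) h
  rw [Real.log_abs] at h2
  rw [abs_le]
  constructor
  · linarith [neg_abs_le (Real.log a)]
  · linarith [abs_nonneg (Real.log a)]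

theorem intervalIntegrable_log_sub_mul (η e : ℂ) (he : ‖e‖ = 1) (a b : ℝ) :
    IntervalIntegrable (fun τ : ℝ => log (η - e * τ)) volume a b := by
  have he0 : e ≠ 0 := norm_ne_zero_iff.1 (by rw [he]; exact one_ne_zero)
  have hlog : IntervalIntegrable (fun τ : ℝ => Real.log ((η / e).re - τ)) volume a b := by
    simpa using (intervalIntegral.intervalIntegrable_log'
      (a := (η / e).re - a) (b := (η / e).re - b)).comp_sub_left (η / e).re
  have hcont : Continuous fun τ : ℝ => ‖η - e * τ‖ + Real.pi := by fun_prop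
  refine ((hcont.intervalIntegrable a b).add hlog.norm).mono_fun
    (measurable_log.comp (by fun_prop)).aestronglyMeasurable ?_
  refine ae_restrict_of_ae ?_
  filter_upwards [Measure.ae_ne volume (η / e).re] with τ hτ
  refine (norm_log_le_of_le_norm (a := (η / e).re - τ) (sub_ne_zero.2 hτ.symm) ?_).trans
    (le_abs_self _)
  have : η - e * τ = e * (η / e - τ) := by field_simp
  rw [this, norm_mul, he, one_mul]
  simpa using abs_re_le_norm (η / e - τ)

/-! ### Branches of the logarithm on half-planes -/

theorem log_eq_of_im_nonneg {w : ℂ} (hw : 0 ≤ w.im) (h0 : w ≠ 0) :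
    log w = log (-I * w) + I * (Real.pi / 2) := by
  have h1 := arg_nonneg_iff.2 hw
  have h2 := arg_le_pi w
  rw [log_mul (neg_ne_zero.2 I_ne_zero) h0, log_neg_I]
  · ring
  · rw [arg_neg_I]
    constructor <;> linarith [Real.pi_pos]

theorem log_eq_of_im_neg {w : ℂ} (hw : w.im < 0) :
    log w = log (I * w) - I * (Real.pi / 2) := by
  have h1 := arg_neg_iff.2 hw
  have h2 := neg_pi_lt_arg w
  rw [log_mul I_ne_zero (by rintro rfl; simp at hw), log_I]
  · ring
  · rw [arg_I]
    constructor <;> linarith [Real.pi_pos]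

theorem logMinus_of_im_ne_zero {w : ℂ} (hw : w.im ≠ 0) : logMinus w = log w := by
  simp [logMinus, hw]

/-- The rotated logarithm is the continuous branch on the closed lower half-plane without 0. On the
negative axis its argument is -π, so there it agrees with `logMinus` and not with the principal
branch. -/
theorem logMinus_eq_of_im_nonpos {w : ℂ} (hw : w.im ≤ 0) (h0 : w ≠ 0) :
    logMinus w = log (I * w) - I * (Real.pi / 2) := by
  rcases hw.lt_or_eq with h | h
  · rw [logMinus_of_im_ne_zero h.ne, log_eq_of_im_neg h]
  · have hwre : w = (w.re : ℂ) := Complex.ext rfl (by simpa using h)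
    rcases lt_or_ge w.re 0 with hr | hr
    · have hI : I * w = ((-w.re : ℝ) : ℂ) * (-I) := by
        rw [hwre]
        push_cast [ofReal_re]
        ring
      have hn : ‖w‖ = -w.re := by
        rw [hwre, norm_real, Real.norm_eq_abs, abs_of_neg (by simpa using hr), ofReal_re]
      rw [logMinus, if_pos ⟨h, hr⟩, hI, log_ofReal_mul (by linarith) (neg_ne_zero.2 I_ne_zero),
        log_neg_I, hn]
      ring
    · have hr' : 0 < w.re := lt_of_le_of_ne hr fun hh => h0 (by rw [hwre, ← hh]; simp)
      rw [logMinus, if_neg (by simp [hr]), hwre, mul_comm I, log_ofReal_mul hr' I_ne_zero, log_I,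
        ← ofReal_log hr]
      ring

theorem log_sub_logMinus (w : ℂ) :
    log w - logMinus w = if w.im = 0 ∧ w.re < 0 then 2 * I * Real.pi else 0 := by
  rw [logMinus]
  split_ifs with h
  · rw [log, arg_eq_pi_iff.2 ⟨h.2, h.1⟩]
    ring
  · simp

theorem continuousAt_zero_mul_log : ContinuousAt (fun w : ℂ => w * log w) 0 := by
  have h : Filter.Tendsto (fun w : ℂ => |‖w‖ * Real.log ‖w‖| + Real.pi * ‖w‖) (nhds 0)
      (nhds 0) := by
    have : Continuous fun w : ℂ => |‖w‖ * Real.log ‖w‖| + Real.pi * ‖w‖ :=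
      (Real.continuous_mul_log.comp continuous_norm).abs.add (by fun_prop)
    simpa using this.tendsto 0
  rw [ContinuousAt, zero_mul]
  refine squeeze_zero_norm (fun w => ?_) h
  rw [norm_mul, abs_mul, abs_norm, mul_comm Real.pi, ← mul_add]
  exact mul_le_mul_of_nonneg_left (norm_log_le_add_pi w) (norm_nonneg w)

/-- The closed right half-plane meets the complement of the slit plane only at 0, where the factor w
tames the logarithm. -/
theorem continuousAt_mul_log_of_re_nonneg {w : ℂ} (hw : 0 ≤ w.re) :
    ContinuousAt (fun w : ℂ => w * log w) w ∧ (w ≠ 0 → w ∈ slitPlane) := by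
  have h : w ≠ 0 → w ∈ slitPlane := fun h0 => by
    rw [mem_slitPlane_iff]
    by_contra! hh
    exact h0 (Complex.ext (le_antisymm hh.1 hw) hh.2)
  refine ⟨?_, h⟩
  by_cases h0 : w = 0
  · rw [h0]
    exact continuousAt_zero_mul_log
  · exact continuousAt_id.mul (continuousAt_clog (h h0))

/-- Integration by parts against `w log w` along a segment which `u` rotates into the closed right
half-plane. -/
theorem integral_mul_log_mul {u c ζ : ℂ} (d : ℂ) {a b : ℝ} (hu : ‖u‖ = 1) (hc : ‖c‖ = 1)
    (hab : a ≤ b) (h : ∀ τ ∈ Set.Icc a b, 0 ≤ (u * (ζ - c * τ)).re) {P Q : ℝ → ℝ}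
    (hP : Continuous P) (hQ : ∀ τ, HasDerivAt Q (P τ) τ) :
    ∫ τ in a..b, (ζ - c * τ) * (log (u * (ζ - c * τ)) + d) * (P τ : ℂ) =
      (ζ - c * b) * (log (u * (ζ - c * b)) + d) * Q b
        - (ζ - c * a) * (log (u * (ζ - c * a)) + d) * Q a
        + c * ∫ τ in a..b, (log (u * (ζ - c * τ)) + d + 1) * (Q τ : ℂ) := by
  have hu0 : u ≠ 0 := norm_ne_zero_iff.1 (by rw [hu]; exact one_ne_zero)
  have hc0 : c ≠ 0 := norm_ne_zero_iff.1 (by rw [hc]; exact one_ne_zero)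
  have hQc : Continuous Q := continuous_iff_continuousAt.2 fun τ => (hQ τ).continuousAt
  have hlog : IntervalIntegrable (fun τ : ℝ => log (u * (ζ - c * τ)) + d) volume a b := by
    have := intervalIntegrable_log_sub_mul (u * ζ) (u * c) (by rw [norm_mul, hu, hc, one_mul]) a b
    simp only [mul_sub, ← mul_assoc]
    exact this.add intervalIntegrable_const
  have hi1 : IntervalIntegrable
      (fun τ : ℝ => (ζ - c * τ) * (log (u * (ζ - c * τ)) + d) * (P τ : ℂ)) volume a b :=
    (hlog.continuousOn_mul (g := fun τ : ℝ => ζ - c * τ) (by fun_prop)).mul_continuousOn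
      (by fun_prop)
  have hi2 : IntervalIntegrable
      (fun τ : ℝ => (log (u * (ζ - c * τ)) + d + 1) * (Q τ : ℂ)) volume a b :=
    (hlog.add intervalIntegrable_const).mul_continuousOn (by fun_prop)
  -- The excepted point is the only possible zero of ζ - c τ; elsewhere the rotated argument lies in
  -- the slit plane, and continuity suffices at the zero.
  have key := integral_eq_of_hasDerivAt_off_countable_of_le
    (fun τ : ℝ => (ζ - c * τ) * (log (u * (ζ - c * τ)) + d) * (Q τ : ℂ))
    (fun τ : ℝ => (ζ - c * τ) * (log (u * (ζ - c * τ)) + d) * (P τ : ℂ)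
      - c * ((log (u * (ζ - c * τ)) + d + 1) * (Q τ : ℂ))) hab
    (Set.countable_singleton (ζ / c).re) ?_ ?_ (hi1.sub (hi2.const_mul c))
  · rw [intervalIntegral.integral_sub hi1 (hi2.const_mul c),
      intervalIntegral.integral_const_mul] at key
    linear_combination key
  · intro τ hτ
    have h1 : ContinuousAt (fun τ : ℝ => (u * (ζ - c * τ)) * log (u * (ζ - c * τ))) τ :=
      ContinuousAt.comp (g := fun w : ℂ => w * log w) (f := fun τ : ℝ => u * (ζ - c * τ))
        (continuousAt_mul_log_of_re_nonneg (h τ hτ)).1 (by fun_prop)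
    have h2 : ContinuousAt (fun τ : ℝ =>
        (u⁻¹ * ((u * (ζ - c * τ)) * log (u * (ζ - c * τ))) + (ζ - c * τ) * d) * (Q τ : ℂ)) τ :=
      ((h1.const_mul _).add (by fun_prop)).mul (by fun_prop)
    refine (h2.congr (Filter.Eventually.of_forall fun t => ?_)).continuousWithinAt
    field_simp
  · rintro τ ⟨hτ, hne⟩
    have hw : ζ - c * τ ≠ 0 := by
      intro hh
      apply hne
      have : ζ / c = τ := by
        field_simp
        linear_combination hh
      rw [this]
      rfl
    have hslit := (continuousAt_mul_log_of_re_nonneg (h τ (Set.Ioo_subset_Icc_self hτ))).2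
      (mul_ne_zero hu0 hw)
    have d1 : HasDerivAt (fun τ : ℝ => ζ - c * (τ : ℂ)) (-c) τ := by
      simpa using ((ofRealCLM.hasDerivAt (x := τ)).const_mul c).const_sub ζ
    have d2 := (d1.mul (((d1.const_mul u).clog_real hslit).add_const d)).mul (hQ τ).ofReal_comp
    refine d2.congr_deriv ?_
    simp only [Pi.mul_apply]
    field_simp
    ring

/-! ### One-dimensional kernels and their integration by parts -/

theorem intervalIntegrable_logKernel (k : ℤ) (z : ℂ) (a b : ℝ) :
    IntervalIntegrable (logKernel k z) volume a b := by
  have h := intervalIntegrable_log_sub_mul z 1 norm_one a b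
  simp only [one_mul] at h
  have hP := continuous_legendreP k
  exact h.mul_continuousOn (by fun_prop)

theorem intervalIntegrable_logKernelI (k : ℤ) (z : ℂ) (a b : ℝ) :
    IntervalIntegrable (logKernelI k z) volume a b := by
  have hP := continuous_legendreP k
  exact (intervalIntegrable_log_sub_mul z I norm_I a b).mul_continuousOn (by fun_prop)

/-- The summand 1 from (w log w)' contributes ∫ Q_k, nonzero only for k = 1; this is the origin of
the constant -2/3 in λ_1. -/
theorem integral_log_add_one_mul_legendreAnti (k : ℕ) (z : ℂ) :
    ∫ s in (-1 : ℝ)..1, (log (z - s) + 1) * (legendreAnti k s : ℂ) =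
      (logL ((k : ℤ) + 1) z - logL ((k : ℤ) - 1) z) / (2 * k + 1)
        + if k = 1 then -2 / 3 else 0 := by
  have hQ : ∫ s in (-1 : ℝ)..1, (legendreAnti k s : ℂ) = if k = 1 then -2 / 3 else 0 := by
    rw [intervalIntegral.integral_ofReal, integral_legendreAnti]
    split_ifs <;> norm_num
  have hc := continuous_legendreAnti k
  rw [← hQ, logL, logL, ← intervalIntegral.integral_sub (intervalIntegrable_logKernel _ _ _ _)
    (intervalIntegrable_logKernel _ _ _ _), ← intervalIntegral.integral_div,
    ← intervalIntegral.integral_add (((intervalIntegrable_logKernel _ _ _ _).sub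
    (intervalIntegrable_logKernel _ _ _ _)).div_const _)
    (Continuous.intervalIntegrable (by fun_prop) _ _)]
  refine intervalIntegral.integral_congr fun s _ => ?_
  simp only [logKernel, legendreAnti_eq]
  push_cast
  ring

theorem integral_log_add_one_mul_legendreAnti_I (k : ℕ) (z : ℂ) :
    ∫ s in (-1 : ℝ)..1, (log (z - I * s) + 1) * (legendreAnti k s : ℂ) =
      (logM ((k : ℤ) + 1) z - logM ((k : ℤ) - 1) z) / (2 * k + 1)
        + if k = 1 then -2 / 3 else 0 := by
  have hQ : ∫ s in (-1 : ℝ)..1, (legendreAnti k s : ℂ) = if k = 1 then -2 / 3 else 0 := by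
    rw [intervalIntegral.integral_ofReal, integral_legendreAnti]
    split_ifs <;> norm_num
  have hc := continuous_legendreAnti k
  rw [← hQ, logM, logM, ← intervalIntegral.integral_sub (intervalIntegrable_logKernelI _ _ _ _)
    (intervalIntegrable_logKernelI _ _ _ _), ← intervalIntegral.integral_div,
    ← intervalIntegral.integral_add (((intervalIntegrable_logKernelI _ _ _ _).sub
    (intervalIntegrable_logKernelI _ _ _ _)).div_const _)
    (Continuous.intervalIntegrable (by fun_prop) _ _)]
  refine intervalIntegral.integral_congr fun s _ => ?_
  simp only [logKernelI, legendreAnti_eq]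
  push_cast
  ring

/-- Integration by parts against `w log w` along a segment which `u` rotates into the closed right
half-plane, if there `log w = log (u w) + d` off one point. -/
theorem integral_mul_log_mul_of_eq {u c ζ : ℂ} (d : ℂ) {a b : ℝ} (hu : ‖u‖ = 1) (hc : ‖c‖ = 1)
    (hab : a ≤ b) (h : ∀ τ ∈ Set.Icc a b, 0 ≤ (u * (ζ - c * τ)).re) {P Q : ℝ → ℝ}
    (hP : Continuous P) (hQ : ∀ τ, HasDerivAt Q (P τ) τ) (r : ℝ)
    (hl : ∀ τ ∈ Set.Icc a b, τ ≠ r → log (ζ - c * τ) = log (u * (ζ - c * τ)) + d) :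
    ∫ τ in a..b, (ζ - c * τ) * (log (ζ - c * τ) * (P τ : ℂ)) =
      (ζ - c * b) * (log (u * (ζ - c * b)) + d) * Q b
        - (ζ - c * a) * (log (u * (ζ - c * a)) + d) * Q a
        + c * ∫ τ in a..b, (log (ζ - c * τ) + 1) * (Q τ : ℂ) := by
  have hae : ∀ᵐ τ : ℝ, τ ∈ Set.uIoc a b → log (ζ - c * τ) = log (u * (ζ - c * τ)) + d := by
    filter_upwards [Measure.ae_ne volume r] with τ hτ hmem
    rw [Set.uIoc_of_le hab] at hmem
    exact hl τ (Set.Ioc_subset_Icc_self hmem) hτ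
  rw [intervalIntegral.integral_congr_ae
      (g := fun τ : ℝ => (ζ - c * τ) * (log (u * (ζ - c * τ)) + d) * (P τ : ℂ)),
    integral_mul_log_mul d hu hc hab h hP hQ, intervalIntegral.integral_congr_ae
      (f := fun τ : ℝ => (log (ζ - c * τ) + 1) * (Q τ : ℂ))
      (g := fun τ : ℝ => (log (u * (ζ - c * τ)) + d + 1) * (Q τ : ℂ))]
  · filter_upwards [hae] with τ hτ hmem
    rw [hτ hmem]
  · filter_upwards [hae] with τ hτ hmem
    rw [hτ hmem, mul_assoc]

theorem mul_log_eq_up {w : ℂ} (hw : 0 ≤ w.im) :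
    w * (log (-I * w) + I * (Real.pi / 2)) = w * log w := by
  by_cases h : w = 0
  · simp [h]
  · rw [← log_eq_of_im_nonneg hw h]

theorem mul_logMinus_eq_down {w : ℂ} (hw : w.im ≤ 0) :
    w * (log (I * w) + -(I * (Real.pi / 2))) = w * logMinus w := by
  by_cases h : w = 0
  · simp [h]
  · rw [logMinus_eq_of_im_nonpos hw h, sub_eq_add_neg]

/-- The points z - s share one imaginary part, so a single rotation works for the whole segment.
Real z belongs to the upper case, because the principal branch on the cut is the limit from above;
hence no jump term. -/
theorem integral_sub_mul_logKernel (k : ℕ) (z : ℂ) :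
    ∫ s in (-1 : ℝ)..1, (z - s) * logKernel k z s =
      (logL ((k : ℤ) + 1) z - logL ((k : ℤ) - 1) z) / (2 * k + 1) + lambdaTerm k z := by
  have main : ∫ s in (-1 : ℝ)..1, (z - s) * logKernel k z s =
      (z - 1) * log (z - 1) * legendreAnti k 1 - (z + 1) * log (z + 1) * legendreAnti k (-1)
        + ∫ s in (-1 : ℝ)..1, (log (z - s) + 1) * (legendreAnti k s : ℂ) := by
    rcases le_or_gt 0 z.im with hz | hz
    · have h := integral_mul_log_mul_of_eq (u := -I) (c := 1) (ζ := z) (I * (Real.pi / 2))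
        (a := -1) (b := 1) (by simp) (by simp) (by norm_num) (fun τ _ => by simpa using hz)
        (continuous_legendreP k) (hasDerivAt_legendreAnti k) z.re (fun τ _ hτ => by
          refine log_eq_of_im_nonneg (by simpa using hz) fun h0 => hτ ?_
          simpa [sub_eq_zero, eq_comm] using congrArg re h0)
      rw [mul_log_eq_up (by simpa using hz), mul_log_eq_up (by simpa using hz)] at h
      simpa [logKernel] using h
    · have h := integral_mul_log_mul_of_eq (u := I) (c := 1) (ζ := z) (-(I * (Real.pi / 2)))
        (a := -1) (b := 1) (by simp) (by simp) (by norm_num) (fun τ _ => by simpa using hz.le)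
        (continuous_legendreP k) (hasDerivAt_legendreAnti k) z.re (fun τ _ hτ => by
          rw [log_eq_of_im_neg (by simpa using hz), sub_eq_add_neg])
      rw [mul_logMinus_eq_down (by simpa using hz.le),
        mul_logMinus_eq_down (by simpa using hz.le), logMinus_of_im_ne_zero (by simpa using hz.ne),
        logMinus_of_im_ne_zero (by simpa using hz.ne)] at h
      simpa [logKernel] using h
  rw [main, integral_log_add_one_mul_legendreAnti, legendreAnti_one, legendreAnti_neg_one,
    lambdaTerm]
  rcases k with _ | _ | k
  all_goals
    simp
    try ring

theorem integral_sub_mul_logKernelI_of_le_im (k : ℕ) (z : ℂ) {a b : ℝ} (hab : a ≤ b)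
    (hb : b ≤ z.im) :
    ∫ t in a..b, (z - I * t) * logKernelI k z t =
      (z - I * b) * log (z - I * b) * legendreAnti k b
        - (z - I * a) * log (z - I * a) * legendreAnti k a
        + I * ∫ t in a..b, (log (z - I * t) + 1) * (legendreAnti k t : ℂ) := by
  have him : ∀ τ ∈ Set.Icc a b, 0 ≤ (z - I * (τ : ℂ)).im := fun τ hτ => by
    simpa using hτ.2.trans hb
  have h := integral_mul_log_mul_of_eq (u := -I) (c := I) (ζ := z) (I * (Real.pi / 2))
    (by simp) (by simp) hab (fun τ hτ => by simpa using him τ hτ)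
    (continuous_legendreP k) (hasDerivAt_legendreAnti k) z.im (fun τ hτ hne => by
      refine log_eq_of_im_nonneg (him τ hτ) fun h0 => hne ?_
      simpa [sub_eq_zero, eq_comm] using congrArg im h0)
  rwa [mul_log_eq_up (him b ⟨hab, le_rfl⟩), mul_log_eq_up (him a ⟨le_rfl, hab⟩)] at h

/-- The part t ≥ y maps to the closed lower half-plane, so boundary values on the cut are limits
from below, that is `logMinus`. The point t = y, where log may lie on the other branch, is null for
the integral. -/
theorem integral_sub_mul_logKernelI_of_im_le (k : ℕ) (z : ℂ) {a b : ℝ} (hab : a ≤ b)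
    (ha : z.im ≤ a) :
    ∫ t in a..b, (z - I * t) * logKernelI k z t =
      (z - I * b) * logMinus (z - I * b) * legendreAnti k b
        - (z - I * a) * logMinus (z - I * a) * legendreAnti k a
        + I * ∫ t in a..b, (log (z - I * t) + 1) * (legendreAnti k t : ℂ) := by
  have him : ∀ τ ∈ Set.Icc a b, (z - I * (τ : ℂ)).im ≤ 0 := fun τ hτ => by
    simpa using ha.trans hτ.1
  have h := integral_mul_log_mul_of_eq (u := I) (c := I) (ζ := z) (-(I * (Real.pi / 2)))
    (by simp) (by simp) hab (fun τ hτ => by simpa using him τ hτ)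
    (continuous_legendreP k) (hasDerivAt_legendreAnti k) z.im (fun τ hτ hne => by
      rw [log_eq_of_im_neg (lt_of_le_of_ne (him τ hτ) fun h0 => hne ?_), sub_eq_add_neg]
      simpa [sub_eq_zero, eq_comm] using h0)
  rwa [mul_logMinus_eq_down (him b ⟨hab, le_rfl⟩), mul_logMinus_eq_down (him a ⟨le_rfl, hab⟩)] at h

/-- For -1 < y < 1 the segment is split at t = y, where w = x. The two one-sided boundary terms
differ by x (log x - log_- x) Q_k(y), which is 2πi x Q_k(y) for x < 0 and 0 otherwise. -/
theorem integral_sub_mul_logKernelI (k : ℕ) (z : ℂ) :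
    ∫ t in (-1 : ℝ)..1, (z - I * t) * logKernelI k z t =
      I * ((logM ((k : ℤ) + 1) z - logM ((k : ℤ) - 1) z) / (2 * k + 1)) + muTerm k z := by
  have main : ∫ t in (-1 : ℝ)..1, (z - I * t) * logKernelI k z t =
      (z - I) * log (z - I) * legendreAnti k 1 - (z + I) * logMinus (z + I) * legendreAnti k (-1)
        + (if z.re < 0 ∧ -1 < z.im ∧ z.im < 1 then
            2 * I * Real.pi * z.re * legendreAnti k z.im else 0)
        + I * ∫ t in (-1 : ℝ)..1, (log (z - I * t) + 1) * (legendreAnti k t : ℂ) := by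
    rcases le_or_gt 1 z.im with h1 | h1
    · rw [integral_sub_mul_logKernelI_of_le_im k z (by norm_num) h1, if_neg (by grind),
        logMinus_of_im_ne_zero (by simp; linarith)]
      simp
    -- The value y = -1 falls here, with z + i real and approached from below, while y = 1 fell in
    -- the upper case; so only the term at z + i carries `logMinus`.
    rcases le_or_gt z.im (-1) with h2 | h2
    · rw [integral_sub_mul_logKernelI_of_im_le k z (by norm_num) h2, if_neg (by grind),
        logMinus_of_im_ne_zero (w := z - I * (1 : ℝ)) (by simp; linarith)]
      simp
    have hi1 : ∀ a b : ℝ, IntervalIntegrable (fun t : ℝ => (z - I * t) * logKernelI k z t)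
        volume a b := fun a b =>
      (intervalIntegrable_logKernelI k z a b).continuousOn_mul (g := fun t : ℝ => z - I * t)
        (by fun_prop)
    have hi2 : ∀ a b : ℝ, IntervalIntegrable
        (fun t : ℝ => (log (z - I * t) + 1) * (legendreAnti k t : ℂ)) volume a b := fun a b => by
      have hc := continuous_legendreAnti k
      exact ((intervalIntegrable_log_sub_mul z I norm_I a b).add
        intervalIntegrable_const).mul_continuousOn (by fun_prop)
    have hzre : z - I * (z.im : ℂ) = (z.re : ℂ) := by
      apply Complex.ext <;> simp
    rw [← intervalIntegral.integral_add_adjacent_intervals (hi1 (-1) z.im) (hi1 z.im 1),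
      ← intervalIntegral.integral_add_adjacent_intervals (hi2 (-1) z.im) (hi2 z.im 1),
      integral_sub_mul_logKernelI_of_le_im k z h2.le le_rfl,
      integral_sub_mul_logKernelI_of_im_le k z h1.le le_rfl, hzre,
      logMinus_of_im_ne_zero (w := z - I * (1 : ℝ)) (by simp; linarith),
      logMinus_of_im_ne_zero (w := z + I) (by simp; linarith)]
    have hl := log_sub_logMinus (z.re : ℂ)
    simp only [ofReal_im, ofReal_re, true_and, h1, h2, and_true] at hl ⊢
    have hif : (if z.re < 0 then 2 * I * Real.pi * z.re * legendreAnti k z.im else 0 : ℂ) =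
        (z.re : ℂ) * legendreAnti k z.im * if z.re < 0 then 2 * I * Real.pi else 0 := by
      split_ifs <;> ring
    rw [hif, ← hl]
    push_cast
    ring_nf
  rw [main, integral_log_add_one_mul_legendreAnti_I, legendreAnti_one, legendreAnti_neg_one,
    muTerm]
  simp only [legendreAnti]
  rcases k with _ | _ | k <;> simp <;> split_ifs <;> ring


/-! ### Integration over the square -/

theorem isCompact_square : IsCompact square := isCompact_Icc.prod isCompact_Icc

theorem integrableOn_square_iff {g : ℝ × ℝ → ℂ} : IntegrableOn g square ↔
    Integrable g ((volume.restrict (Set.Icc (-1 : ℝ) 1)).prod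
      (volume.restrict (Set.Icc (-1 : ℝ) 1))) := by
  rw [Measure.prod_restrict, ← Measure.volume_eq_prod]
  rfl

theorem intervalIntegral_eq_integral_Icc (f : ℝ → ℂ) :
    ∫ t in (-1 : ℝ)..1, f t = ∫ t in Set.Icc (-1 : ℝ) 1, f t := by
  rw [intervalIntegral.integral_of_le (by norm_num), integral_Icc_eq_integral_Ioc]

theorem intervalIntegrable_of_integrable_Icc {f : ℝ → ℂ}
    (hf : Integrable f (volume.restrict (Set.Icc (-1 : ℝ) 1))) :
    IntervalIntegrable f volume (-1) 1 :=
  (intervalIntegrable_iff_integrableOn_Icc_of_le (by norm_num)).2 hf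

theorem integral_square_eq {g : ℝ × ℝ → ℂ} (hg : IntegrableOn g square) :
    ∫ p in square, g p = ∫ s in (-1 : ℝ)..1, ∫ t in (-1 : ℝ)..1, g (s, t) := by
  have := integral_prod g (integrableOn_square_iff.1 hg)
  rw [Measure.prod_restrict, ← Measure.volume_eq_prod] at this
  simpa only [square, intervalIntegral_eq_integral_Icc] using this

theorem integral_square_eq_symm {g : ℝ × ℝ → ℂ} (hg : IntegrableOn g square) :
    ∫ p in square, g p = ∫ t in (-1 : ℝ)..1, ∫ s in (-1 : ℝ)..1, g (s, t) := by
  have := integral_prod_symm g (integrableOn_square_iff.1 hg)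
  rw [Measure.prod_restrict, ← Measure.volume_eq_prod] at this
  simpa only [square, intervalIntegral_eq_integral_Icc] using this

theorem intervalIntegrable_integral_right {g : ℝ × ℝ → ℂ} (hg : IntegrableOn g square) :
    IntervalIntegrable (fun s => ∫ t in (-1 : ℝ)..1, g (s, t)) volume (-1) 1 := by
  simp only [intervalIntegral_eq_integral_Icc]
  exact intervalIntegrable_of_integrable_Icc (integrableOn_square_iff.1 hg).integral_prod_left

theorem intervalIntegrable_integral_left {g : ℝ × ℝ → ℂ} (hg : IntegrableOn g square) :
    IntervalIntegrable (fun t => ∫ s in (-1 : ℝ)..1, g (s, t)) volume (-1) 1 := by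
  simp only [intervalIntegral_eq_integral_Icc]
  exact intervalIntegrable_of_integrable_Icc (integrableOn_square_iff.1 hg).integral_prod_right

/-- The bound by log|y - t| depends on t alone and is integrable over the square, even when the
singularity lies inside. -/
theorem integrableOn_log_square (z : ℂ) :
    IntegrableOn (fun p : ℝ × ℝ => log (z - (p.1 + I * p.2))) square := by
  have hcont : Continuous fun p : ℝ × ℝ => ‖z - (p.1 + I * p.2)‖ + Real.pi := by fun_prop
  have hlog : IntegrableOn (fun t : ℝ => Real.log (z.im - t)) (Set.Icc (-1) 1) := by
    rw [← intervalIntegrable_iff_integrableOn_Icc_of_le (by norm_num)]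
    simpa using (intervalIntegral.intervalIntegrable_log'
      (a := z.im + 1) (b := z.im - 1)).comp_sub_left z.im
  have hlog₂ : IntegrableOn (fun p : ℝ × ℝ => Real.log (z.im - p.2)) square := by
    rw [IntegrableOn, square, Measure.volume_eq_prod, ← Measure.prod_restrict]
    exact Integrable.comp_snd hlog _
  refine ((hcont.continuousOn.integrableOn_compact isCompact_square).add hlog₂.norm).mono'
    (measurable_log.comp (by fun_prop)).aestronglyMeasurable ?_
  refine ae_restrict_of_ae ?_
  have hne : ∀ᵐ p : ℝ × ℝ, p.2 ≠ z.im :=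
    Measure.quasiMeasurePreserving_snd.ae (Measure.ae_ne volume z.im)
  filter_upwards [hne] with p hp
  refine norm_log_le_of_le_norm (a := z.im - p.2) (sub_ne_zero.2 hp.symm) ?_
  simpa using abs_im_le_norm (z - (p.1 + I * p.2))

theorem integrableOn_logKernel₂ (k j : ℤ) (z : ℂ) : IntegrableOn (logKernel₂ k j z) square := by
  have hk := continuous_legendreP k
  have hj := continuous_legendreP j
  exact (integrableOn_log_square z).mul_continuousOn (by fun_prop) isCompact_square

theorem logKernel₂_eq_logKernel (k j : ℤ) (z : ℂ) (s t : ℝ) :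
    logKernel₂ k j z (s, t) = legendreP j t * logKernel k (z - I * t) s := by
  rw [logKernel₂, logKernel, show z - I * t - s = z - (s + I * t) by ring]
  push_cast
  ring

theorem logKernel₂_eq_logKernelI (k j : ℤ) (z : ℂ) (s t : ℝ) :
    logKernel₂ k j z (s, t) = legendreP k s * logKernelI j (z - s) t := by
  rw [logKernel₂, logKernelI, show z - s - I * t = z - (s + I * t) by ring]
  push_cast
  ring

theorem logL₂_eq_integral_logL (k j : ℤ) (z : ℂ) :
    logL₂ k j z = ∫ t in (-1 : ℝ)..1, legendreP j t * logL k (z - I * t) := by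
  rw [logL₂, integral_square_eq_symm (integrableOn_logKernel₂ k j z)]
  simp only [logKernel₂_eq_logKernel, intervalIntegral.integral_const_mul, logL]

theorem logL₂_eq_integral_logM (k j : ℤ) (z : ℂ) :
    logL₂ k j z = ∫ s in (-1 : ℝ)..1, legendreP k s * logM j (z - s) := by
  rw [logL₂, integral_square_eq (integrableOn_logKernel₂ k j z)]
  simp only [logKernel₂_eq_logKernelI, intervalIntegral.integral_const_mul, logM]

/-- The function is an inner integral in Fubini's theorem, so no regularity of L_k is needed. -/
theorem intervalIntegrable_logL (k j : ℤ) (z : ℂ) :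
    IntervalIntegrable (fun t : ℝ => legendreP j t * logL k (z - I * t)) volume (-1) 1 := by
  simpa only [logL, logKernel₂_eq_logKernel, intervalIntegral.integral_const_mul] using
    intervalIntegrable_integral_left (integrableOn_logKernel₂ k j z)

theorem intervalIntegrable_logM (k j : ℤ) (z : ℂ) :
    IntervalIntegrable (fun s : ℝ => legendreP k s * logM j (z - s)) volume (-1) 1 := by
  simpa only [logM, logKernel₂_eq_logKernelI, intervalIntegral.integral_const_mul] using
    intervalIntegrable_integral_right (integrableOn_logKernel₂ k j z)

theorem integrableOn_sub_mul_logKernel₂ (k j : ℤ) (z : ℂ) :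
    IntegrableOn (fun p : ℝ × ℝ => (z - (p.1 + I * p.2)) * logKernel₂ k j z p) square :=
  (integrableOn_logKernel₂ k j z).continuousOn_mul
    (g := fun p : ℝ × ℝ => z - (p.1 + I * p.2)) (by fun_prop) isCompact_square

theorem mul_logL₂ (k j : ℕ) (z : ℂ) :
    z * logL₂ k j z = (∫ p in square, (z - (p.1 + I * p.2)) * logKernel₂ k j z p)
      + ((k : ℂ) / (2 * k + 1) * logL₂ ((k : ℤ) - 1) j z
        + ((k : ℂ) + 1) / (2 * k + 1) * logL₂ ((k : ℤ) + 1) j z)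
      + I * ((j : ℂ) / (2 * j + 1) * logL₂ k ((j : ℤ) - 1) z
        + ((j : ℂ) + 1) / (2 * j + 1) * logL₂ k ((j : ℤ) + 1) z) := by
  have hi : ∀ (c : ℂ) (k j : ℤ), Integrable (fun p => c * logKernel₂ k j z p)
      (volume.restrict square) := fun c k j => (integrableOn_logKernel₂ k j z).const_mul c
  have hi₂ : ∀ (c d : ℂ) (k j k' j' : ℤ), Integrable
      (fun p => c * logKernel₂ k j z p + d * logKernel₂ k' j' z p) (volume.restrict square) :=
    fun c d k j k' j' => (hi c k j).add (hi d k' j')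
  have hw : Integrable (fun p : ℝ × ℝ => (z - (p.1 + I * p.2)) * logKernel₂ k j z p)
    (volume.restrict square) := integrableOn_sub_mul_logKernel₂ k j z
  have hw₂ : ∀ (c d : ℂ) (k' j' k'' j'' : ℤ), Integrable (fun p : ℝ × ℝ =>
      (z - (p.1 + I * p.2)) * logKernel₂ k j z p
        + (c * logKernel₂ k' j' z p + d * logKernel₂ k'' j'' z p)) (volume.restrict square) :=
    fun c d k' j' k'' j'' => hw.add (hi₂ c d k' j' k'' j'')
  simp only [logL₂]
  simp only [← integral_const_mul]
  rw [← integral_add (hi _ _ _) (hi _ _ _), ← integral_add (hi _ _ _) (hi _ _ _),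
    ← integral_const_mul, ← integral_add hw (hi₂ _ _ _ _ _ _),
    ← integral_add (hw₂ _ _ _ _ _ _) ((hi₂ _ _ _ _ _ _).const_mul I)]
  refine integral_congr_ae (Filter.Eventually.of_forall fun p => ?_)
  have h1 := congrArg (fun r : ℝ => (r : ℂ)) (mul_legendreP k p.1)
  have h2 := congrArg (fun r : ℝ => (r : ℂ)) (mul_legendreP j p.2)
  simp only [logKernel₂] at h1 h2 ⊢
  push_cast at h1 h2 ⊢
  linear_combination log (z - (p.1 + I * p.2)) * legendreP j p.2 * h1
    + I * log (z - (p.1 + I * p.2)) * legendreP k p.1 * h2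

theorem integral_legendreP_complex (k : ℕ) :
    ∫ s in (-1 : ℝ)..1, (legendreP k s : ℂ) = if k = 0 then 2 else 0 := by
  rw [intervalIntegral.integral_ofReal, integral_legendreP]
  split_ifs <;> norm_num

/-! ### The first recurrence -/

/-- For k = 0 the boundary terms are w log w on the vertical segments based at z ∓ 1, so
`integral_sub_mul_logKernelI` applies once more; for k = 1 orthogonality leaves -2/3 · 2 at j = 0.
-/
theorem integral_legendreP_mul_lambdaTerm (k j : ℕ) (z : ℂ) :
    IntervalIntegrable (fun t : ℝ => legendreP j t * lambdaTerm k (z - I * t)) volume (-1) 1 ∧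
      ∫ t in (-1 : ℝ)..1, legendreP j t * lambdaTerm k (z - I * t) = inhomOne k j z := by
  have hP := continuous_legendreP j
  match k with
  | 0 =>
    have hi : ∀ w : ℂ, IntervalIntegrable (fun t : ℝ => (w - I * t) * logKernelI j w t)
        volume (-1) 1 := fun w =>
      (intervalIntegrable_logKernelI j w _ _).continuousOn_mul (g := fun t : ℝ => w - I * t)
        (by fun_prop)
    have he : (fun t : ℝ => legendreP j t * lambdaTerm 0 (z - I * t)) = fun t : ℝ =>
        (z - 1 - I * t) * logKernelI j (z - 1) t + (z + 1 - I * t) * logKernelI j (z + 1) t := by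
      funext t
      rw [lambdaTerm, if_pos rfl, logKernelI, logKernelI,
        show z - I * t - 1 = z - 1 - I * t by ring, show z - I * t + 1 = z + 1 - I * t by ring]
      ring
    rw [he]
    refine ⟨(hi _).add (hi _), ?_⟩
    rw [intervalIntegral.integral_add (hi _) (hi _), integral_sub_mul_logKernelI,
      integral_sub_mul_logKernelI, inhomOne, if_pos rfl]
    ring
  | 1 =>
    simp only [lambdaTerm, one_ne_zero, if_false, if_true]
    refine ⟨Continuous.intervalIntegrable (by fun_prop) _ _, ?_⟩
    rw [intervalIntegral.integral_mul_const, integral_legendreP_complex, inhomOne]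
    by_cases hj : j = 0
    · simp [hj]
      norm_num
    · simp [hj]
  | k + 2 => simp [lambdaTerm, inhomOne]

theorem integral_sub_mul_logKernel₂_left (k j : ℕ) (z : ℂ) :
    ∫ p in square, (z - (p.1 + I * p.2)) * logKernel₂ k j z p =
      (logL₂ ((k : ℤ) + 1) j z - logL₂ ((k : ℤ) - 1) j z) / (2 * k + 1) + inhomOne k j z := by
  obtain ⟨hi, he⟩ := integral_legendreP_mul_lambdaTerm k j z
  rw [integral_square_eq_symm (integrableOn_sub_mul_logKernel₂ k j z), ← he,
    logL₂_eq_integral_logL, logL₂_eq_integral_logL, ← intervalIntegral.integral_sub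
      (intervalIntegrable_logL _ _ _) (intervalIntegrable_logL _ _ _),
    ← intervalIntegral.integral_div, ← intervalIntegral.integral_add
      (((intervalIntegrable_logL _ _ _).sub (intervalIntegrable_logL _ _ _)).div_const _) hi]
  refine intervalIntegral.integral_congr fun t _ => ?_
  have h : ∀ s : ℝ, (z - (s + I * t)) * logKernel₂ k j z (s, t) =
      legendreP j t * ((z - I * t - s) * logKernel k (z - I * t) s) := fun s => by
    rw [logKernel₂_eq_logKernel]
    ring
  simp only [h, intervalIntegral.integral_const_mul, integral_sub_mul_logKernel]
  ring

/-! ### The second recurrence -/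

theorem intervalIntegrable_ite_sub_mul_legendreP (k : ℕ) (x a b : ℝ) :
    IntervalIntegrable (fun s : ℝ => (if x < s then s - x else 0) * legendreP k s) volume a b := by
  have hP := continuous_legendreP k
  have he : (fun s : ℝ => (if x < s then s - x else 0) * legendreP k s) =
      fun s => max (s - x) 0 * legendreP k s := by
    funext s
    split_ifs with h
    · rw [max_eq_left (by linarith)]
    · rw [max_eq_right (by linarith)]
  rw [he]
  exact Continuous.intervalIntegrable (by fun_prop) _ _

/-- The vertical segment at abscissa s meets the cut only if x - s < 0, so the jumps integrate to a
moment of the positive part of s - x. The cases record how much of [-1, 1] lies to the right of x.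
-/
theorem integral_ite_sub_mul_legendreP (k : ℕ) (x : ℝ) :
    ∫ s in (-1 : ℝ)..1, (if x < s then s - x else 0) * legendreP k s =
      if x < -1 then (if k = 0 then -2 * x else 0) + (if k = 1 then 2 / 3 else 0)
      else if x ≤ 1 then ultraspherical (-3 / 2) (k + 2) x / 3 - (if k = 0 then x else 0)
        + (if k = 1 then 1 / 3 else 0)
      else 0 := by
  have hi := intervalIntegrable_ite_sub_mul_legendreP k x
  have above : ∀ a b : ℝ, a ≤ b → x ≤ a →
      ∫ s in a..b, (if x < s then s - x else 0) * legendreP k s =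
        ∫ s in a..b, (s - x) * legendreP k s := fun a b hab ha => by
    refine intervalIntegral.integral_congr fun s hs => ?_
    rw [Set.uIcc_of_le hab] at hs
    rcases (ha.trans hs.1).lt_or_eq with h | h
    · simp [h]
    · simp [h]
  have below : ∀ a b : ℝ, a ≤ b → b ≤ x →
      ∫ s in a..b, (if x < s then s - x else 0) * legendreP k s = 0 := fun a b hab hb => by
    rw [intervalIntegral.integral_congr (g := fun _ => (0 : ℝ)) fun s hs => ?_]
    · simp
    · rw [Set.uIcc_of_le hab] at hs
      simp [(hs.2.trans hb).not_gt]
  by_cases h1 : x < -1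
  · rw [if_pos h1, above _ _ (by norm_num) h1.le, integral_sub_mul_legendreP_Icc]
  rw [if_neg h1]
  by_cases h2 : x ≤ 1
  · rw [if_pos h2, ← intervalIntegral.integral_add_adjacent_intervals (hi (-1) x) (hi x 1),
      below _ _ (not_lt.1 h1) le_rfl, above _ _ h2 le_rfl, zero_add,
      integral_sub_mul_legendreP_right]
  · rw [if_neg h2]
    exact below _ _ (by norm_num) (not_le.1 h2).le

theorem betaFactor_eq_integral (k : ℕ) (z : ℂ) :
    betaFactor k z = if -1 ≤ z.im ∧ z.im < 1 then
      ∫ s in (-1 : ℝ)..1, (if z.re < s then s - z.re else 0) * legendreP k s else 0 := by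
  rw [integral_ite_sub_mul_legendreP, betaFactor]
  simp only [square, Set.mem_prod, Set.mem_Icc]
  by_cases hy : -1 ≤ z.im ∧ z.im < 1
  · rw [if_pos hy]
    by_cases h1 : z.re < -1
    · rw [if_neg (by grind), if_pos ⟨h1, hy⟩, if_pos h1]
    · rw [if_neg h1]
      by_cases h2 : z.re ≤ 1
      · rw [if_pos (by grind), if_pos h2]
      · rw [if_neg (by grind), if_neg (by grind), if_neg h2]
  · rw [if_neg hy, if_neg (by grind), if_neg (by grind)]

theorem ultraspherical_neg_half_neg_one (j : ℕ) :
    ultraspherical (-1 / 2) (j + 1) (-1) = if j = 0 then 1 else 0 := by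
  have h := legendreAnti_neg_one j
  rw [legendreAnti] at h
  split_ifs at h ⊢ <;> linarith

/-- Trades log_- for the principal branch by enlarging the strip to include y = -1: there the two
differ by 2πi if x < 0, and C_{j+1}^{(-1/2)}(-1) = δ_{j0} makes the jump term match. This is why β
includes y = -1 but not y = 1. -/
theorem muTerm_eq (j : ℕ) (z : ℂ) :
    muTerm j z =
      (if j = 0 then (z - I) * log (z - I) + (z + I) * log (z + I)
        else if j = 1 then -2 * I / 3 else 0)
      + 2 * I * Real.pi * ultraspherical (-1 / 2) (j + 1) z.im *
        (if -1 ≤ z.im ∧ z.im < 1 then (if z.re < 0 then -z.re else 0 : ℝ) else 0 : ℝ) := by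
  by_cases hy : z.im = -1
  · have hzI : z + I = z.re := by
      apply Complex.ext <;> simp [hy]
    have hl := log_sub_logMinus (z + I)
    rw [hzI] at hl
    rw [muTerm, hzI, hy, ultraspherical_neg_half_neg_one, if_neg (c := z.re < 0 ∧ _) (by grind),
      if_pos (c := _ ∧ _) (by norm_num)]
    by_cases hj : j = 0
    · simp only [ofReal_im, ofReal_re, true_and] at hl
      simp only [hj, if_true]
      rw [← sub_eq_zero]
      have : (((if z.re < 0 then -z.re else 0 : ℝ)) : ℂ) * (2 * I * Real.pi)
          = -z.re * (if z.re < 0 then 2 * I * Real.pi else 0) := by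
        split_ifs <;> push_cast <;> ring
      push_cast at this ⊢
      linear_combination -this - z.re * hl
    · simp [hj]
  · rw [muTerm, logMinus_of_im_ne_zero (w := z + I) (by
      simpa [← eq_neg_iff_add_eq_zero] using hy)]
    have : (-1 ≤ z.im ∧ z.im < 1) ↔ (-1 < z.im ∧ z.im < 1) := by grind
    simp only [this]
    by_cases h1 : -1 < z.im ∧ z.im < 1
    · by_cases h2 : z.re < 0
      · simp only [h1, h2, and_self, if_true]
        push_cast
        ring
      · simp [h2]
    · simp [h1]

theorem integral_legendreP_mul_muTerm (k j : ℕ) (z : ℂ) :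
    IntervalIntegrable (fun s : ℝ => legendreP k s * muTerm j (z - s)) volume (-1) 1 ∧
      ∫ s in (-1 : ℝ)..1, legendreP k s * muTerm j (z - s) = inhomTwo k j z := by
  have hP := continuous_legendreP k
  -- The integrand is split into a principal-branch part A and a cut part C · B; the shift by s
  -- leaves y unchanged, so C is constant and B integrates to `betaFactor`.
  set C : ℂ := 2 * I * Real.pi * ultraspherical (-1 / 2) (j + 1) z.im with hC
  set A : ℝ → ℂ := fun s => legendreP k s *
    (if j = 0 then (z - s - I) * log (z - s - I) + (z - s + I) * log (z - s + I)
        else if j = 1 then -2 * I / 3 else 0) with hA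
  set B : ℝ → ℝ := fun s => if -1 ≤ z.im ∧ z.im < 1 then
    (if z.re < s then s - z.re else 0) * legendreP k s else 0 with hB
  have he : (fun s : ℝ => legendreP k s * muTerm j (z - s)) = fun s => A s + C * (B s : ℂ) := by
    funext s
    have hb : (B s : ℂ) = legendreP k s *
        (if -1 ≤ z.im ∧ z.im < 1 then (if z.re < s then s - z.re else 0 : ℝ) else 0 : ℝ) := by
      rw [hB, ← ofReal_mul]
      congr 1
      simp only [mul_ite, mul_zero, mul_comm]
    rw [hb, muTerm_eq]
    simp only [sub_re, ofReal_re, sub_im, ofReal_im, sub_zero, sub_neg, neg_sub, hA, hC]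
    ring
  have hBi : IntervalIntegrable B volume (-1) 1 := by
    by_cases h : -1 ≤ z.im ∧ z.im < 1
    · simpa only [hB, if_pos h] using intervalIntegrable_ite_sub_mul_legendreP k z.re _ _
    · simp [hB, if_neg h]
  have hBint : ∫ s in (-1 : ℝ)..1, B s = betaFactor k z := by
    rw [betaFactor_eq_integral, hB]
    split_ifs <;> simp
  have hBi' : IntervalIntegrable (fun s => C * (B s : ℂ)) volume (-1) 1 :=
    IntervalIntegrable.const_mul ⟨hBi.1.ofReal, hBi.2.ofReal⟩ C
  have hBint' : ∫ s in (-1 : ℝ)..1, C * (B s : ℂ) = betaTerm k j z := by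
    rw [intervalIntegral.integral_const_mul, intervalIntegral.integral_ofReal, hBint, betaTerm]
  suffices h : IntervalIntegrable A volume (-1) 1 ∧
      (∫ s in (-1 : ℝ)..1, A s) + betaTerm k j z = inhomTwo k j z by
    rw [he]
    refine ⟨h.1.add hBi', ?_⟩
    rw [intervalIntegral.integral_add h.1 hBi', hBint', h.2]
  clear he hBint' hBi' hBint hBi
  match j with
  | 0 =>
    have hi : ∀ w : ℂ, IntervalIntegrable (fun s : ℝ => (w - s) * logKernel k w s)
        volume (-1) 1 := fun w =>
      (intervalIntegrable_logKernel k w _ _).continuousOn_mul (g := fun s : ℝ => w - s)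
        (by fun_prop)
    have he : A = fun s : ℝ =>
        (z - I - s) * logKernel k (z - I) s + (z + I - s) * logKernel k (z + I) s := by
      funext s
      simp only [hA, if_true]
      rw [logKernel, logKernel, show z - s - I = z - I - s by ring,
        show z - s + I = z + I - s by ring]
      ring
    rw [he]
    refine ⟨(hi _).add (hi _), ?_⟩
    rw [intervalIntegral.integral_add (hi _) (hi _), integral_sub_mul_logKernel,
      integral_sub_mul_logKernel, inhomTwo, if_pos rfl]
    ring
  | 1 =>
    simp only [hA, one_ne_zero, if_false, if_true]
    refine ⟨Continuous.intervalIntegrable (by fun_prop) _ _, ?_⟩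
    rw [intervalIntegral.integral_mul_const, integral_legendreP_complex, inhomTwo]
    by_cases hk : k = 0
    · simp [hk]
      ring
    · simp [hk]
  | j + 2 => simp [hA, inhomTwo]

theorem integral_sub_mul_logKernel₂_right (k j : ℕ) (z : ℂ) :
    ∫ p in square, (z - (p.1 + I * p.2)) * logKernel₂ k j z p =
      I * ((logL₂ k ((j : ℤ) + 1) z - logL₂ k ((j : ℤ) - 1) z) / (2 * j + 1))
        + inhomTwo k j z := by
  obtain ⟨hi, he⟩ := integral_legendreP_mul_muTerm k j z
  rw [integral_square_eq (integrableOn_sub_mul_logKernel₂ k j z), ← he,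
    logL₂_eq_integral_logM, logL₂_eq_integral_logM, ← intervalIntegral.integral_sub
      (intervalIntegrable_logM _ _ _) (intervalIntegrable_logM _ _ _),
    ← intervalIntegral.integral_div, ← intervalIntegral.integral_const_mul,
    ← intervalIntegral.integral_add ((((intervalIntegrable_logM _ _ _).sub
      (intervalIntegrable_logM _ _ _)).div_const _).const_mul _) hi]
  refine intervalIntegral.integral_congr fun s _ => ?_
  have h : ∀ t : ℝ, (z - (s + I * t)) * logKernel₂ k j z (s, t) =
      legendreP k s * ((z - s - I * t) * logKernelI j (z - s) t) := fun t => by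
    rw [logKernel₂_eq_logKernelI]
    ring
  simp only [h, intervalIntegral.integral_const_mul, integral_sub_mul_logKernelI]
  ring

end NewtonianLog

theorem mainTheorem3 (z : ℂ) :
    (∀ k : ℕ, IntervalIntegrable (NewtonianLog.logKernel k z) MeasureTheory.volume (-1) 1) ∧
    (∀ k : ℕ, IntervalIntegrable (NewtonianLog.logKernelI k z) MeasureTheory.volume (-1) 1) ∧
    ∀ k j : ℕ,
      MeasureTheory.IntegrableOn (NewtonianLog.logKernel₂ k j z) NewtonianLog.square ∧
      z * NewtonianLog.logL₂ k j z =
        ((k : ℂ) - 1) / (2 * k + 1) * NewtonianLog.logL₂ ((k : ℤ) - 1) j z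
        + ((k : ℂ) + 2) / (2 * k + 1) * NewtonianLog.logL₂ ((k : ℤ) + 1) j z
        + Complex.I * ((j : ℂ) / (2 * j + 1) * NewtonianLog.logL₂ k ((j : ℤ) - 1) z
          + ((j : ℂ) + 1) / (2 * j + 1) * NewtonianLog.logL₂ k ((j : ℤ) + 1) z)
        + NewtonianLog.inhomOne k j z ∧
      z * NewtonianLog.logL₂ k j z =
        (k : ℂ) / (2 * k + 1) * NewtonianLog.logL₂ ((k : ℤ) - 1) j z
        + ((k : ℂ) + 1) / (2 * k + 1) * NewtonianLog.logL₂ ((k : ℤ) + 1) j z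
        + Complex.I * (((j : ℂ) - 1) / (2 * j + 1) * NewtonianLog.logL₂ k ((j : ℤ) - 1) z
          + ((j : ℂ) + 2) / (2 * j + 1) * NewtonianLog.logL₂ k ((j : ℤ) + 1) z)
        + NewtonianLog.inhomTwo k j z := by
  refine ⟨fun k => NewtonianLog.intervalIntegrable_logKernel k z _ _,
    fun k => NewtonianLog.intervalIntegrable_logKernelI k z _ _, fun k j =>
    ⟨NewtonianLog.integrableOn_logKernel₂ k j z, ?_, ?_⟩⟩
  · rw [NewtonianLog.mul_logL₂, NewtonianLog.integral_sub_mul_logKernel₂_left]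
    ring
  · rw [NewtonianLog.mul_logL₂, NewtonianLog.integral_sub_mul_logKernel₂_right]
    ring
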